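/- Let $R$ be a semilocal principal ideal domain in which $2$ is invertible, with field of fractions $K$, and let $q : V \to R$ be a quadratic form on a free $R$-module $V$ of finite rank, with polar form $b_q(v,w)=q(v+w)-q(v)-q(w)$. The radical of a quadratic form is the kernel of the adjoint map of its polar form. Assume that $q$ has simple degeneration of multiplicity one, that is: (i) for every maximal ideal $\mathfrak{m}$ of $R$, the radical of the form $q\otimes_R \kappa(\mathfrak{m})$ over the residue field $\kappa(\mathfrak{m})$ has dimension at most $1$; (ii) for every maximal ideal $\mathfrak{m}$ at which this radical is nonzero, there is an isometry $q\otimes_R R_{\mathfrak{m}} \cong \langle u_1,\dots,u_{r-1},u_r\pi\rangle$ over the local ring $R_{\mathfrak{m}}$, where $r$ is the rank of $V$, $u_1,\dots,u_r \in R_{\mathfrak{m}}^{\times}$, $\pi$ is a prime element of $R_{\mathfrak{m}}$, and $\langle a_1,\dots,a_r\rangle$ denotes the form $\sum_i a_i x_i^2$. Let $u\in R^{\times}$ be a unit. If $u$ is represented by $q$ over $K$, i.e. there is $v\in V\otimes_R K$ with $q_K(v)=u$, then $u$ is represented by $q$ over $R$, i.e. there is $v\in V$ with $q(v)=u$. 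-/

import Mathlib

open scoped TensorProduct

noncomputable section

namespace QuadraticForm

/-- The radical of a quadratic form: the kernel of the adjoint map `ψ_q : V → Hom(V, R)` of the
polar form `b_q(v, w) = q(v + w) - q(v) - q(w)`. -/
def polarRadical {R V : Type*} [CommRing R] [AddCommGroup V] [Module R V]
    (q : QuadraticForm R V) : Submodule R V :=
  LinearMap.ker (QuadraticMap.polarBilin q)

variable {R V : Type*} [CommRing R] [Invertible (2 : R)] [AddCommGroup V] [Module R V]

/-- The fibre of `q` at a prime `p`: the form `q ⊗ κ(p)` over the residue field of `R_p`. -/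
abbrev fibre (q : QuadraticForm R V) (p : Ideal R) [p.IsPrime] :
    QuadraticForm p.ResidueField (p.ResidueField ⊗[R] V) :=
  q.baseChange p.ResidueField

/-- Simple degeneration: at every closed point, the fibre has radical of dimension at most one. -/
def HasSimpleDegeneration (q : QuadraticForm R V) : Prop :=
  ∀ (m : Ideal R) [m.IsMaximal],
    Module.finrank m.ResidueField (q.fibre m).polarRadical ≤ 1

/-- `m` lies in the locus (the support of the discriminant divisor) where the fibre of `q` has a
nontrivial radical. -/
def DegeneratesAt (q : QuadraticForm R V) (m : Ideal R) [m.IsMaximal] : Prop :=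
  (q.fibre m).polarRadical ≠ ⊥

/-- Over the local ring `R_m`, the form `q` is isometric to a diagonal form
`⟨u₁, …, u_n, u π ^ e⟩` (of rank `n + 1`) with `u₁, …, u_n, u` units and `π` a parameter. -/
def HasMultiplicityAt (q : QuadraticForm R V) (m : Ideal R) [m.IsMaximal] (e : ℕ) : Prop :=
  ∃ (n : ℕ) (u : Fin n → (Localization.AtPrime m)ˣ) (u' : (Localization.AtPrime m)ˣ)
    (π : Localization.AtPrime m), Irreducible π ∧
    QuadraticMap.Equivalent (q.baseChange (Localization.AtPrime m))
      (QuadraticMap.weightedSumSquares (Localization.AtPrime m)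
        (Fin.snoc (fun i => (u i : Localization.AtPrime m)) (u' * π ^ e) :
          Fin (n + 1) → Localization.AtPrime m))

/-- Simple degeneration of multiplicity one along every component of the discriminant divisor,
for a form over a ring (such as a principal ideal domain) in which those components are
closed points. -/
def HasSimpleDegenerationOfMultiplicityOne (q : QuadraticForm R V) : Prop :=
  q.HasSimpleDegeneration ∧
    ∀ (m : Ideal R) [m.IsMaximal], q.DegeneratesAt m → q.HasMultiplicityAt m 1

end QuadraticForm

end

/-!
Write `b` for the polar form of `q`. A vector `w` of `V` and a nonzero `d` in `R` with
`q w = d² u` amount to a representation of `u` over `K`; one has to make `d` a unit.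

* Take such a pair with `d` minimal for divisibility. If `d` lies in a maximal ideal `m = (p)`, then
  some value `b(w, y)` lies outside `m`. For otherwise `w` is in the radical of the fibre at `m`, and
  then `w ∈ pV` (`exists_eq_smul_of_polar_mem`), so that `p` can be divided out of `w` and `d`. At a
  point of degeneration this is where multiplicity one enters: in a diagonalisation
  `⟨u₁, …, uₙ, u'π⟩` the first `n` coordinates of `w` are divisible by `π`, and since `π²` divides
  `q w = d² u`, it divides `u'π` times the square of the last coordinate, so `π` divides this
  coordinate too.
* The vector `(w, d)` is isotropic for `q ⊥ ⟨-u⟩`. Its reflection in `(y, 1)`, scaled by the value of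
  the form at `(y, 1)`, is again isotropic, with last coordinate `(q y + u) d - b(w, y)`
  (`map_smul_sub_smul_eq`). This is a unit if, at the maximal ideals containing `d`, `b(w, y)` is a
  unit, while `y` vanishes at the others. Such a `y` is given by the Chinese remainder theorem, as a
  multiple of a vector at which `b(w, ·)` takes a generator of its ideal of values.
-/

namespace QuadraticForm

open _root_.QuadraticMap IsLocalRing

/-! ### Values of polar forms -/

theorem polar_weightedSumSquares_single {A ι : Type*} [CommRing A] [Fintype ι] [DecidableEq ι]
    (a x : ι → A) (i : ι) :
    polar (weightedSumSquares A a) x (Pi.single i 1) = 2 * (a i * x i) := by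
  simp only [polar, weightedSumSquares_apply, ← Finset.sum_sub_distrib, Pi.add_apply, smul_eq_mul]
  rw [Finset.sum_eq_single i]
  · simp only [Pi.single_eq_same]
    ring
  · intro j _ hj
    simp [Pi.single_eq_of_ne hj]
  · simp

theorem polar_baseChange_one_tmul {R V : Type*} [CommRing R] [Invertible (2 : R)] [AddCommGroup V]
    [Module R V] (A : Type*) [CommRing A] [Algebra R A] (q : QuadraticForm R V) (w : V) (a : A)
    (y : V) :
    polar (q.baseChange A) (1 ⊗ₜ w) (a ⊗ₜ y) = a * algebraMap R A (polar q w y) := by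
  have h : (a ⊗ₜ[R] y : A ⊗[R] V) = a • ((1 : A) ⊗ₜ[R] y) := by
    rw [TensorProduct.smul_tmul', smul_eq_mul, mul_one]
  rw [h, polar_smul_right, smul_eq_mul]
  simp only [polar, ← TensorProduct.tmul_add, baseChange_tmul, mul_one, Algebra.smul_def, map_sub]

/-- The values of `b_q(w, ·)` after base change lie in any ideal that contains those before. -/
theorem polar_baseChange_mem {R V : Type*} [CommRing R] [Invertible (2 : R)] [AddCommGroup V]
    [Module R V] {A : Type*} [CommRing A] [Algebra R A] (q : QuadraticForm R V) (w : V)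
    (I : Ideal A) (h : ∀ y, algebraMap R A (polar q w y) ∈ I) (z : A ⊗[R] V) :
    polar (q.baseChange A) (1 ⊗ₜ w) z ∈ I := by
  induction z with
  | zero => rw [polar_zero_right]; exact I.zero_mem
  | tmul a y => rw [polar_baseChange_one_tmul]; exact I.mul_mem_left _ (h y)
  | add x y hx hy => rw [polar_add_right]; exact I.add_mem hx hy

/-! ### Vectors whose image in the fibre is in the radical -/

/-- For a diagonal form `⟨u₁, …, uₙ, u'π⟩` over a local ring with uniformizer `π`, a vector which is
radical modulo `π` and whose value is divisible by `π²` is itself divisible by `π`. -/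
theorem exists_eq_smul_of_equivalent {A W : Type*} [CommRing A] [IsDomain A]
    [IsPrincipalIdealRing A] [IsLocalRing A] [Invertible (2 : A)] [AddCommGroup W] [Module A W]
    (Q : QuadraticForm A W) {n : ℕ} (u : Fin n → Aˣ) (u' : Aˣ) {π : A} (hπ : Irreducible π)
    (e : Q.Equivalent (weightedSumSquares A
      (Fin.snoc (fun i => (u i : A)) (u' * π) : Fin (n + 1) → A)))
    (w : W) (hw : ∀ z, polar Q w z ∈ maximalIdeal A) (hQ : π ^ 2 ∣ Q w) :
    ∃ z, w = π • z := by
  obtain ⟨e⟩ := e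
  set a : Fin (n + 1) → A := Fin.snoc (fun i => (u i : A)) (u' * π)
  have hmax : maximalIdeal A = Ideal.span {π} :=
    (eq_maximalIdeal (PrincipalIdealRing.isMaximal_of_irreducible hπ)).symm
  have hpolar (i) : π ∣ a i * e w i := by
    have h := hw (e.symm (Pi.single i 1))
    have h2 : polar Q w (e.symm (Pi.single i 1)) =
        polar (weightedSumSquares A a) (e w) (Pi.single i 1) := by
      have h3 : e (e.symm (Pi.single i 1)) = Pi.single i 1 := e.toLinearEquiv.apply_symm_apply _
      simp only [polar]
      rw [← e.map_app, ← e.map_app w, ← e.map_app (e.symm _), map_add, h3]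
    rw [h2, polar_weightedSumSquares_single, hmax, Ideal.mem_span_singleton] at h
    exact ((isUnit_of_invertible (2 : A)).dvd_mul_left).mp h
  have hinit (i : Fin n) : π ∣ e w i.castSucc := by
    have h := hpolar i.castSucc
    have hai : a i.castSucc = u i := Fin.snoc_castSucc ..
    rw [hai] at h
    exact ((u i).isUnit.dvd_mul_left).mp h
  have hlast : π ∣ e w (Fin.last n) := by
    rw [← e.map_app, weightedSumSquares_apply, Fin.sum_univ_castSucc] at hQ
    rw [dvd_add_right (Finset.dvd_sum fun i _ => ?_)] at hQ
    · have hal : a (Fin.last n) = u' * π := Fin.snoc_last ..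
      rw [hal, smul_eq_mul, pow_two, mul_assoc, u'.isUnit.dvd_mul_left,
        mul_dvd_mul_iff_left hπ.ne_zero] at hQ
      exact (hπ.prime.dvd_or_dvd hQ).elim id id
    · rw [smul_eq_mul, ← pow_two]
      exact (pow_dvd_pow_of_dvd (hinit i) 2).mul_left _
  have hall (i) : π ∣ e w i := Fin.lastCases hlast hinit i
  choose x hx using hall
  refine ⟨e.symm x, e.toLinearEquiv.injective ?_⟩
  change e w = e (π • e.symm x)
  rw [map_smul]
  have h3 : e (e.symm x) = x := e.toLinearEquiv.apply_symm_apply _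
  rw [h3]
  exact funext hx

theorem isPrincipalIdealRing_of_isLocalization {R : Type*} [CommRing R] [IsPrincipalIdealRing R]
    (S : Submonoid R) (A : Type*) [CommRing A] [Algebra R A] [IsLocalization S A] :
    IsPrincipalIdealRing A := by
  refine ⟨fun J => ?_⟩
  obtain ⟨g, hg⟩ :=
    (IsPrincipalIdealRing.principal (Ideal.under R J)).principal
  refine ⟨algebraMap R A g, ?_⟩
  rw [← IsLocalization.map_under S A J, hg]
  change Ideal.map _ (Ideal.span {g}) = Ideal.span _
  rw [Ideal.map_span, Set.image_singleton]

/-- If `w` is radical in the fibre at `m = (p)` and `p²` divides `q w`, then `w` vanishes in the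
fibre. If the fibre is nondegenerate this holds by definition; otherwise the diagonalisation of `q`
over the local ring at `m` is used. -/
theorem exists_eq_smul_of_polar_mem {R V : Type*} [CommRing R] [IsDomain R] [IsPrincipalIdealRing R]
    [Invertible (2 : R)] [AddCommGroup V] [Module R V] [Module.Finite R V] [Module.Free R V]
    (q : QuadraticForm R V)
    (hq : q.HasSimpleDegenerationOfMultiplicityOne) {p : R} (hp : (Ideal.span {p}).IsMaximal)
    (w : V) (hw : ∀ y, polar q w y ∈ Ideal.span {p}) (hpw : p ^ 2 ∣ q w) :
    ∃ z, w = p • z := by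
  set m := Ideal.span {p} with hm
  let B := Module.Free.chooseBasis R V
  -- divisibility by `p` is tested on coordinates
  suffices h : ∀ i, B.repr w i ∈ m by
    simp only [hm, Ideal.mem_span_singleton] at h
    choose c hc using h
    refine ⟨∑ i, c i • B i, ?_⟩
    conv_lhs => rw [← B.sum_repr w]
    rw [Finset.smul_sum]
    exact Finset.sum_congr rfl fun i _ => by rw [hc, mul_smul]
  by_cases hdeg : q.DegeneratesAt m
  · obtain ⟨n, u, u', π, hπ, e⟩ := hq.2 m hdeg
    rw [pow_one] at e
    let : Invertible (2 : Localization.AtPrime m) :=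
      (Invertible.map (algebraMap R (Localization.AtPrime m)) 2).copy 2 (map_ofNat _ _).symm
    have : IsPrincipalIdealRing (Localization.AtPrime m) :=
      isPrincipalIdealRing_of_isLocalization m.primeCompl _
    have hmax : maximalIdeal (Localization.AtPrime m) = Ideal.span {π} :=
      (eq_maximalIdeal (PrincipalIdealRing.isMaximal_of_irreducible hπ)).symm
    have hloc (x : R) (hx : x ∈ m) :
        algebraMap R (Localization.AtPrime m) x ∈ maximalIdeal (Localization.AtPrime m) :=
      (IsLocalization.AtPrime.to_map_mem_maximal_iff _ m x).mpr hx
    obtain ⟨z, hz⟩ := exists_eq_smul_of_equivalent (q.baseChange (Localization.AtPrime m)) u u' hπ e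
      (1 ⊗ₜ w) (polar_baseChange_mem q w _ fun y => hloc _ (hw y)) (by
        rw [baseChange_tmul, mul_one, Algebra.smul_def, mul_one]
        have h := hloc p (Ideal.mem_span_singleton_self p)
        rw [hmax, Ideal.mem_span_singleton] at h
        exact (pow_dvd_pow_of_dvd h 2).trans (by rw [← map_pow]; exact map_dvd _ hpw))
    intro i
    rw [← IsLocalization.AtPrime.to_map_mem_maximal_iff (Localization.AtPrime m) m, hmax,
      Ideal.mem_span_singleton]
    have h := B.baseChange_repr_tmul (S := Localization.AtPrime m) 1 w i
    rw [hz, map_smul, Finsupp.smul_apply, smul_eq_mul, Algebra.smul_def, mul_one] at h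
    exact ⟨_, h.symm⟩
  · intro i
    have hrad : (1 ⊗ₜ w : m.ResidueField ⊗[R] V) ∈ (q.fibre m).polarRadical := by
      rw [polarRadical, LinearMap.mem_ker]
      ext y
      simpa using polar_baseChange_mem (A := m.ResidueField) q w ⊥
        (fun y => by simpa [Ideal.algebraMap_residueField_eq_zero] using hw y) (1 ⊗ₜ y)
    rw [DegeneratesAt, not_not] at hdeg
    rw [hdeg, Submodule.mem_bot] at hrad
    have h := B.baseChange_repr_tmul (S := m.ResidueField) 1 w i
    rw [hrad, map_zero, Finsupp.zero_apply, Algebra.smul_def, mul_one] at h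
    exact Ideal.algebraMap_residueField_eq_zero.mp h.symm

/-! ### Representations with minimal denominator -/

theorem exists_map_eq_sq_mul {R V : Type*} [CommRing R] [Invertible (2 : R)] [AddCommGroup V]
    [Module R V] (K : Type*) [Field K] [Algebra R K] [IsFractionRing R K]
    (q : QuadraticForm R V) (u : R) (v : K ⊗[R] V) (hv : q.baseChange K v = algebraMap R K u) :
    ∃ (d : R) (w : V), d ∈ nonZeroDivisors R ∧ q w = d ^ 2 * u := by
  obtain ⟨⟨w, d⟩, h⟩ := IsLocalizedModule.surj (nonZeroDivisors R) (TensorProduct.mk R K V 1) v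
  refine ⟨d, w, d.2, IsFractionRing.injective R K ?_⟩
  have h1 : q.baseChange K (1 ⊗ₜ w) = algebraMap R K (q w) := by
    rw [baseChange_tmul, mul_one, Algebra.smul_def, mul_one]
  have h2 : algebraMap R K d • v = 1 ⊗ₜ w := by
    rw [algebraMap_smul]
    exact h
  rw [← h1, ← h2, QuadraticMap.map_smul, hv, smul_eq_mul, map_mul, map_pow, pow_two]

theorem exists_map_eq_sq_mul_and_polar_notMem {R V : Type*} [CommRing R] [IsDomain R] [IsPrincipalIdealRing R]
    [Invertible (2 : R)] [AddCommGroup V] [Module R V] [Module.Finite R V] [Module.Free R V]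
    (q : QuadraticForm R V)
    (hq : q.HasSimpleDegenerationOfMultiplicityOne) (u : R)
    (h : ∃ (d : R) (w : V), d ∈ nonZeroDivisors R ∧ q w = d ^ 2 * u) :
    ∃ (d : R) (w : V), q w = d ^ 2 * u ∧
      ∀ m : Ideal R, m.IsMaximal → d ∈ m → ∃ y, polar q w y ∉ m := by
  obtain ⟨d₀, hd₀⟩ := h
  obtain ⟨d, ⟨w, hd, hw⟩, hmin⟩ := (wellFounded_dvdNotUnit (α := R)).has_min
    {d | ∃ w : V, d ∈ nonZeroDivisors R ∧ q w = d ^ 2 * u} ⟨d₀, hd₀⟩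
  refine ⟨d, w, hw, fun m hm hdm => ?_⟩
  by_contra! hpolar
  obtain ⟨p, rfl⟩ := (IsPrincipalIdealRing.principal m).principal
  change (Ideal.span {p}).IsMaximal at hm
  obtain ⟨d', rfl⟩ := Ideal.mem_span_singleton.mp hdm
  have hpd := nonZeroDivisors.ne_zero hd
  have hp : p ≠ 0 := left_ne_zero_of_mul hpd
  obtain ⟨z, rfl⟩ := exists_eq_smul_of_polar_mem q hq hm w hpolar
    (by rw [hw, mul_pow, mul_assoc]; exact dvd_mul_right _ _)
  refine hmin d' ⟨z, mem_nonZeroDivisors_of_ne_zero (right_ne_zero_of_mul hpd), ?_⟩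
    ⟨right_ne_zero_of_mul hpd, p, fun hu => hm.ne_top (Ideal.span_singleton_eq_top.mpr hu),
      mul_comm _ _⟩
  rw [QuadraticMap.map_smul, smul_eq_mul] at hw
  exact mul_left_cancel₀ (mul_ne_zero hp hp) (by rw [hw]; ring)

/-! ### Moving the isotropic vector -/

/-- If `(w, d)` is isotropic for `q ⊥ ⟨-u⟩`, then so is its reflection in `(y, 1)`, scaled by the
value `q y - u` of that form at `(y, 1)`. -/
theorem map_smul_sub_smul_eq {R V : Type*} [CommRing R] [AddCommGroup V] [Module R V]
    (q : QuadraticForm R V) {u d : R} {w : V} (hw : q w = d ^ 2 * u)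
    (y : V) :
    q ((q y - u) • w - (polar q w y - 2 * u * d) • y) =
      ((q y + u) * d - polar q w y) ^ 2 * u := by
  rw [sub_eq_add_neg, ← neg_smul, QuadraticMap.map_add q, polar_smul_left, polar_smul_right,
    QuadraticMap.map_smul, QuadraticMap.map_smul, hw]
  simp only [smul_eq_mul]
  ring

theorem exists_isUnit_mul_sub_polar {R V : Type*} [CommRing R] [IsPrincipalIdealRing R]
    [Finite (MaximalSpectrum R)] [AddCommGroup V] [Module R V] (q : QuadraticForm R V)
    (u : Rˣ) (d : R) (w : V)
    (h : ∀ m : Ideal R, m.IsMaximal → d ∈ m → ∃ y, polar q w y ∉ m) :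
    ∃ y, IsUnit ((q y + u) * d - polar q w y) := by
  classical
  obtain ⟨g, hg⟩ := (IsPrincipalIdealRing.principal (LinearMap.range (polarBilin q w))).principal
  have hg' (y : V) : g ∣ polar q w y := by
    have : polarBilin q w y ∈ LinearMap.range (polarBilin q w) := ⟨y, rfl⟩
    rw [hg] at this
    exact Ideal.mem_span_singleton.mp this
  obtain ⟨y, hy⟩ : g ∈ LinearMap.range (polarBilin q w) := by
    rw [hg]; exact Submodule.mem_span_singleton_self g
  replace hy : polar q w y = g := hy
  have hcop : Pairwise (Function.onFun IsCoprime fun m : MaximalSpectrum R => m.asIdeal) :=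
    fun m m' hne => Ideal.isCoprime_iff_sup_eq.mpr <|
      m.isMaximal.coprime_of_ne m'.isMaximal fun h => hne (MaximalSpectrum.ext h)
  obtain ⟨c, hc⟩ := Ideal.exists_forall_sub_mem_ideal hcop
    fun m : MaximalSpectrum R => if d ∈ m.asIdeal then 1 else 0
  -- modulo `m` the element in question is `-g` if `d ∈ m`, and `u d` otherwise
  refine ⟨c • y, ?_⟩
  by_contra hnu
  obtain ⟨m, hm, hmem⟩ := exists_max_ideal_of_mem_nonunits hnu
  have hcm := hc ⟨m, hm⟩
  rw [QuadraticMap.map_smul, polar_smul_right, hy, smul_eq_mul, smul_eq_mul] at hmem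
  by_cases hd : d ∈ m
  · simp only [hd, if_true] at hcm
    obtain ⟨x, hx⟩ := h m hm hd
    refine hx (m.mem_of_dvd (hg' x) ?_)
    have h1 := m.sub_mem (m.mul_mem_left (c * c * q y + u) hd)
      (m.add_mem hmem (m.mul_mem_right g hcm))
    convert h1 using 1
    ring
  · simp only [hd, if_false, sub_zero] at hcm
    refine hd ?_
    have h1 := m.mul_mem_left (↑u⁻¹ : R)
      (m.sub_mem hmem (m.mul_mem_right (c * q y * d - g) hcm))
    convert h1 using 1
    linear_combination (-d) * u.inv_mul

end QuadraticForm

theorem mainTheorem8 {R : Type*} [CommRing R] [IsDomain R] [IsPrincipalIdealRing R]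
    [Finite (MaximalSpectrum R)] [Invertible (2 : R)]
    {K : Type*} [Field K] [Algebra R K] [IsFractionRing R K]
    {V : Type*} [AddCommGroup V] [Module R V] [Module.Finite R V] [Module.Projective R V]
    (q : QuadraticForm R V) (hq : q.HasSimpleDegenerationOfMultiplicityOne)
    (u : Rˣ) (hu : ∃ v : K ⊗[R] V, q.baseChange K v = algebraMap R K (u : R)) :
    ∃ v : V, q v = (u : R) := by

  obtain ⟨v, hv⟩ := hu
  obtain ⟨d, w, hw, hpolar⟩ := q.exists_map_eq_sq_mul_and_polar_notMem hq u
    (q.exists_map_eq_sq_mul K u v hv)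
  obtain ⟨y, hy⟩ := q.exists_isUnit_mul_sub_polar u d w hpolar
  -- the new isotropic vector has last coordinate a unit `s`; divide by it
  obtain ⟨s, hs⟩ := hy
  have h := q.map_smul_sub_smul_eq hw y
  rw [← hs] at h
  refine ⟨(↑s⁻¹ : R) • ((q y - u) • w - (QuadraticMap.polar q w y - 2 * u * d) • y), ?_⟩
  rw [QuadraticMap.map_smul, h, smul_eq_mul]
  linear_combination (u * (s⁻¹ * s + 1) : R) * s.inv_mul
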